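/- Let $A=(a_1,\dots,a_n)$ be an integer $m\times n$ matrix whose columns generate $\mathbb{Z}^m$ and whose row span over $\mathbb{Q}$ contains $(1,\dots,1)$. Let $I_A\subset\mathbb{C}[x_1,\dots,x_n]$ be its toric ideal, generated by all binomials $x^u-x^v$ with $u,v\in\mathbb{N}^n$ and $Au=Av$, let $\mathcal{L}_A=\{v\in\mathbb{Z}^n: Av=0\}$, and put $r=n-m$, the rank of $\mathcal{L}_A$. For an integer $n\times r$ matrix $B$ whose columns $v_1,\dots,v_r$ lie in $\mathcal{L}_A$ and are linearly independent over $\mathbb{Q}$, the ideal $J_B=\langle x^{v_j^+}-x^{v_j^-} : 1\le j\le r\rangle$ is called a basis ideal; here $v_j=v_j^+-v_j^-$ is the decomposition of $v_j$ into its positive and negative parts. A circuit of $\mathcal{L}_A$ is a nonzero vector of $\mathcal{L}_A$ whose support is minimal under inclusion among the supports of nonzero vectors of $\mathcal{L}_A$; the basis ideal $J_B$ is said to be generated by circuits if every column of $B$ is a circuit. An ideal is a complete intersection if it can be generated by as many elements as its height. Then $I_A$ contains a basis ideal $J_B$ that is a complete intersection if and only if $I_A$ contains a basis ideal $J_C$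 that is a complete intersection and is generated by circuits. -/

import Mathlib

namespace ToricCI

noncomputable section

variable {m n r : ℕ}

/-- A configuration: the columns `a_1, …, a_n` of the `m × n` integer matrix `A` generate `ℤ^m`,
and the vector `(1, …, 1)` lies in the (rational) row span of `A`. -/
structure IsConfiguration (A : Matrix (Fin m) (Fin n) ℤ) : Prop where
  span_col : Submodule.span ℤ (Set.range A.col) = ⊤
  one_mem_span_row :
    (fun _ => 1 : Fin n → ℚ) ∈ Submodule.span ℚ (Set.range (A.map (Int.cast : ℤ → ℚ)).row)

/-- The toric ideal `I_A ⊆ ℂ[x_1, …, x_n]`, generated by all binomials `x^u - x^v` with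
`u, v ∈ ℕ^n` and `A u = A v`. -/
def toricIdeal (A : Matrix (Fin m) (Fin n) ℤ) : Ideal (MvPolynomial (Fin n) ℂ) :=
  Ideal.span {f | ∃ u v : Fin n →₀ ℕ,
    A.mulVec (fun i => (u i : ℤ)) = A.mulVec (fun i => (v i : ℤ)) ∧
    f = MvPolynomial.monomial u 1 - MvPolynomial.monomial v 1}

/-- The lattice `L_A = {v ∈ ℤ^n : A v = 0}`. -/
def kernelLattice (A : Matrix (Fin m) (Fin n) ℤ) : Submodule ℤ (Fin n → ℤ) :=
  LinearMap.ker A.mulVecLin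

/-- The positive part `v⁺ ∈ ℕ^n` of an integer vector `v`; the negative part is `posExponent (-v)`. -/
def posExponent (v : Fin n → ℤ) : Fin n →₀ ℕ :=
  Finsupp.equivFunOnFinite.symm fun i => (v i).toNat

/-- The binomial `x^{v⁺} - x^{v⁻}`. -/
def binomial (v : Fin n → ℤ) : MvPolynomial (Fin n) ℂ :=
  MvPolynomial.monomial (posExponent v) 1 - MvPolynomial.monomial (posExponent (-v)) 1

/-- The ideal `J_B`, generated by the binomials of the columns of `B`. -/
def basisIdeal (B : Matrix (Fin n) (Fin r) ℤ) : Ideal (MvPolynomial (Fin n) ℂ) :=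
  Ideal.span (Set.range fun j => binomial (B.col j))

/-- The columns of `B` form a maximal family of vectors of `L_A` that is linearly independent over
`ℚ`. For a configuration one has `m ≤ n`, and `L_A` has rank `n - m`, so that maximality is expressed
by the number `n - m` of columns. -/
structure IsLatticeVectorSpaceBasis (A : Matrix (Fin m) (Fin n) ℤ)
    (B : Matrix (Fin n) (Fin (n - m)) ℤ) : Prop where
  col_mem : ∀ j, B.col j ∈ kernelLattice A
  linearIndependent : LinearIndependent ℚ (B.map (Int.cast : ℤ → ℚ)).col

/-- A circuit of `L_A`: a nonzero vector of `L_A` whose support is minimal, with respect to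
inclusion, among the supports of the nonzero vectors of `L_A`. -/
def IsCircuit (A : Matrix (Fin m) (Fin n) ℤ) (v : Fin n → ℤ) : Prop :=
  v ∈ kernelLattice A ∧ v ≠ 0 ∧
    ∀ u ∈ kernelLattice A, u ≠ 0 → Function.support u ⊆ Function.support v →
      Function.support u = Function.support v

/-- An ideal is a complete intersection if it can be generated by as many elements as its height
(codimension). The unit ideal has height `⊤` and is therefore excluded. -/
def IsCompleteIntersection {R : Type*} [CommRing R] (I : Ideal R) : Prop :=
  ∃ s : Finset R, Ideal.span (s : Set R) = I ∧ (s.card : ℕ∞) = I.height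

end

end ToricCI

/-! Only the passage to circuits needs proof. Write $r$ for the number of columns. For linearly
independent lattice vectors, complete intersection means height at least $r$, since Krull bounds the
height by $r$. Columns are exchanged for circuits one at a time, keeping independence and height.

A lattice vector $v$ is a rational combination of circuits conformal to it
(`exists_conformal_circuits_span`), so Steinitz exchange yields such a circuit $c$ preserving
independence. For the height (`le_height_familyIdeal_update`), take a minimal prime $P$ of the new
ideal. If $P$ contains a variable in the support of $c$, it contains variables on both sign sides of
$c$, hence of $v$, so $P$ contains the old ideal. Otherwise let $K$ be the variables in $P$ and $T$
the new vectors vanishing on $K$. Then $P$ has height at least $|K|+|T|$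
(`card_add_card_le_height`), while the old ideal lies in a proper ideal with $|K|+|T|$ generators,
so $r\le |K|+|T|$. -/

namespace ToricCI

noncomputable section

variable {m n r : ℕ}

/-! ### Conformal vectors, circuits and exchange -/

/-- `c` is sign-compatible with `v`. -/
def Conformal {ι : Type*} (c v : ι → ℤ) : Prop :=
  ∀ i, (0 < c i → 0 < v i) ∧ (c i < 0 → v i < 0)

namespace Conformal

variable {ι : Type*} {a b c : ι → ℤ}

theorem refl (a : ι → ℤ) : Conformal a a := fun _ => ⟨id, id⟩

theorem trans (h : Conformal a b) (h' : Conformal b c) : Conformal a c :=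
  fun i => ⟨fun hi => (h' i).1 ((h i).1 hi), fun hi => (h' i).2 ((h i).2 hi)⟩

theorem apply_ne_zero (h : Conformal a b) {i : ι} (hi : a i ≠ 0) : b i ≠ 0 := by
  rcases lt_or_gt_of_ne hi with hi | hi
  · exact ((h i).2 hi).ne
  · exact ((h i).1 hi).ne'

end Conformal

/-- Subtracting from `v` the largest multiple of `u` that keeps the signs of `v`. -/
theorem exists_conformal_sub {ι : Type*} [Fintype ι] {u v : ι → ℤ}
    (huv : ∀ i, u i ≠ 0 → v i ≠ 0) (h : ∃ i, 0 < u i * v i) :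
    ∃ p q : ℤ, 0 < p ∧ 0 < q ∧ Conformal (q • v - p • u) v ∧
      ∃ i, v i ≠ 0 ∧ (q • v - p • u) i = 0 := by
  classical
  obtain ⟨j, hj⟩ := h
  -- The smallest ratio marks the first coordinate to vanish as multiples of `u` are subtracted;
  -- clearing denominators gives `p = |v k|` and `q = |u k|`.
  obtain ⟨k, hk, hmin⟩ := Finset.exists_min_image (Finset.univ.filter fun i => 0 < u i * v i)
    (fun i => (|v i| : ℚ) / |u i|) ⟨j, by simpa using hj⟩
  simp only [Finset.mem_filter, Finset.mem_univ, true_and] at hk hmin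
  have huk : u k ≠ 0 := by rintro h; simp [h] at hk
  have hvk : v k ≠ 0 := by rintro h; simp [h] at hk
  have hp : 0 < |v k| := abs_pos.2 hvk
  have hq : 0 < |u k| := abs_pos.2 huk
  have key : ∀ i, 0 < u i * v i → |v k| * |u i| ≤ |v i| * |u k| := by
    intro i hi
    have hui : u i ≠ 0 := by rintro h; simp [h] at hi
    have := hmin i hi
    rw [div_le_div_iff₀ (by exact_mod_cast hq) (by exact_mod_cast abs_pos.2 hui)] at this
    exact_mod_cast this
  refine ⟨|v k|, |u k|, hp, hq, fun i => ?_, k, hvk, ?_⟩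
  · simp only [Pi.sub_apply, Pi.smul_apply, smul_eq_mul]
    rcases lt_trichotomy (v i) 0 with hv | hv | hv
    · refine ⟨fun hw => ?_, fun _ => hv⟩
      exfalso
      rcases lt_or_ge (u i) 0 with hu | hu
      · have := key i (mul_pos_of_neg_of_neg hu hv)
        rw [abs_of_neg hu, abs_of_neg hv] at this
        linarith
      · nlinarith [mul_nonneg hp.le hu]
    · have : u i = 0 := by
        by_contra h
        exact huv i h hv
      simp [hv, this]
    · refine ⟨fun _ => hv, fun hw => ?_⟩
      exfalso
      rcases lt_or_ge 0 (u i) with hu | hu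
      · have := key i (mul_pos hu hv)
        rw [abs_of_pos hu, abs_of_pos hv] at this
        linarith
      · nlinarith [mul_nonneg hp.le (neg_nonneg.2 hu)]
  · simp only [Pi.sub_apply, Pi.smul_apply, smul_eq_mul]
    rcases lt_or_gt_of_ne huk with hu | hu
    · have hv : v k < 0 := by by_contra h; nlinarith
      rw [abs_of_neg hu, abs_of_neg hv]; ring
    · have hv : 0 < v k := by by_contra h; nlinarith
      rw [abs_of_pos hu, abs_of_pos hv]; ring

theorem sub_mem_kernelLattice {A : Matrix (Fin m) (Fin n) ℤ} {u v : Fin n → ℤ}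
    (hu : u ∈ kernelLattice A) (hv : v ∈ kernelLattice A) (p q : ℤ) :
    q • v - p • u ∈ kernelLattice A :=
  sub_mem (Submodule.smul_mem _ _ hv) (Submodule.smul_mem _ _ hu)

/-- A vector of the lattice which is not a circuit has a nonzero conformal lattice vector
of strictly smaller support. -/
theorem exists_conformal_support_ssubset {A : Matrix (Fin m) (Fin n) ℤ} {v : Fin n → ℤ}
    (hv : v ∈ kernelLattice A) (hv0 : v ≠ 0) (hc : ¬ IsCircuit A v) :
    ∃ w ∈ kernelLattice A, w ≠ 0 ∧ Conformal w v ∧ ∃ i, v i ≠ 0 ∧ w i = 0 := by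
  simp only [IsCircuit, not_and, not_forall] at hc
  obtain ⟨u, hu, hu0, hs, hne⟩ := hc hv hv0
  have hsub : ∀ i, u i ≠ 0 → v i ≠ 0 := fun i hi => hs hi
  obtain ⟨k, hvk, huk⟩ : ∃ k, v k ≠ 0 ∧ u k = 0 := by
    by_contra! h
    exact hne (Set.Subset.antisymm hs fun i hi => h i hi)
  -- This is applied to `u` or `-u`, whichever agrees in sign with `v` somewhere. Coordinate `k`
  -- becomes `q * v k`, so the difference is nonzero.
  have main : ∀ u' ∈ kernelLattice A, (∀ i, u' i ≠ 0 → v i ≠ 0) → u' k = 0 →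
      (∃ i, 0 < u' i * v i) →
      ∃ w ∈ kernelLattice A, w ≠ 0 ∧ Conformal w v ∧ ∃ i, v i ≠ 0 ∧ w i = 0 := by
    intro u' hu' hsub' hk hpos
    obtain ⟨p, q, hp, hq, hconf, hz⟩ := exists_conformal_sub hsub' hpos
    refine ⟨_, sub_mem_kernelLattice hu' hv p q, fun h => ?_, hconf, hz⟩
    have := congrFun h k
    simp [hk, hvk, hq.ne'] at this
  obtain ⟨i, hi⟩ : ∃ i, u i ≠ 0 := by
    by_contra! h
    exact hu0 (funext h)
  rcases lt_or_gt_of_ne (mul_ne_zero hi (hsub i hi)) with h | h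
  · exact main (-u) (neg_mem hu) (fun i hi => hsub i (by simpa using hi)) (by simp [huk])
      ⟨i, by simpa using h⟩
  · exact main u hu hsub huk ⟨i, h⟩

/-- The image of an integer vector in `ℚ^n`. -/
def ratCast (v : Fin n → ℤ) : Fin n → ℚ := fun i => v i

/-- Induction on the size of the support: a vector that is not a circuit is a rational combination
of two conformal lattice vectors of smaller support. -/
theorem exists_conformal_circuits_span {A : Matrix (Fin m) (Fin n) ℤ} {v : Fin n → ℤ}
    (hv : v ∈ kernelLattice A) (hv0 : v ≠ 0) :
    ratCast v ∈ Submodule.span ℚ (ratCast '' {c | IsCircuit A c ∧ Conformal c v}) := by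
  classical
  induction hN : (Finset.univ.filter fun i => v i ≠ 0).card using Nat.strong_induction_on
    generalizing v with
  | _ N ih =>
  by_cases hc : IsCircuit A v
  · exact Submodule.subset_span ⟨v, ⟨hc, Conformal.refl v⟩, rfl⟩
  have small : ∀ w ∈ kernelLattice A, Conformal w v → (∃ i, v i ≠ 0 ∧ w i = 0) →
      ratCast w ∈ Submodule.span ℚ (ratCast '' {c | IsCircuit A c ∧ Conformal c v}) := by
    rintro w hw hwv ⟨i, hvi, hwi⟩
    by_cases hw0 : w = 0
    · have : ratCast w = 0 := by ext; simp [ratCast, hw0]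
      rw [this]; exact zero_mem _
    refine Submodule.span_mono (Set.image_mono ?_) (ih _ ?_ hw hw0 rfl)
    · exact fun c hc => ⟨hc.1, hc.2.trans hwv⟩
    · rw [← hN]
      refine Finset.card_lt_card (Finset.ssubset_iff_of_subset ?_ |>.2 ⟨i, ?_, ?_⟩)
      · intro j hj
        simp only [Finset.mem_filter, Finset.mem_univ, true_and] at hj ⊢
        exact hwv.apply_ne_zero hj
      · simpa using hvi
      · simpa using hwi
  obtain ⟨w, hw, hw0, hwv, hz⟩ := exists_conformal_support_ssubset hv hv0 hc
  obtain ⟨i, hi⟩ : ∃ i, w i ≠ 0 := by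
    by_contra! h
    exact hw0 (funext h)
  obtain ⟨p, q, hp, hq, hconf, hz'⟩ := exists_conformal_sub (u := w) (v := v)
    (fun i hi => hwv.apply_ne_zero hi) ⟨i, by
      rcases lt_or_gt_of_ne hi with h | h
      · exact mul_pos_of_neg_of_neg h ((hwv i).2 h)
      · exact mul_pos h ((hwv i).1 h)⟩
  have h1 := small w hw hwv hz
  have h2 := small _ (sub_mem_kernelLattice hw hv p q) hconf hz'
  have hq' : (q : ℚ) ≠ 0 := by exact_mod_cast hq.ne'
  have : ratCast v = (q : ℚ)⁻¹ • (ratCast (q • v - p • w) + (p : ℚ) • ratCast w) := by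
    ext j
    simp [ratCast]
    field_simp
  rw [this]
  exact Submodule.smul_mem _ _ (add_mem h2 (Submodule.smul_mem _ _ h1))

/-- Steinitz exchange: a member of a linearly independent family that lies in the span of `S`
can be replaced by an element of `S`. -/
theorem exists_linearIndependent_update {ι V : Type*} [DecidableEq ι] [AddCommGroup V] [Module ℚ V]
    {b : ι → V} (hb : LinearIndependent ℚ b) (j : ι) {S : Set V}
    (hS : b j ∈ Submodule.span ℚ S) :
    ∃ c ∈ S, LinearIndependent ℚ (Function.update b j c) := by
  by_contra! h
  -- If no exchange works, every element of `S` lies in the span of the other vectors, hence so does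
  -- `b j`.
  refine hb.notMem_span_image (s := {j}ᶜ) (x := j) (by simp) ?_
  refine Submodule.span_le.2 (fun c hc => ?_) hS
  by_contra hcn
  refine h c hc ?_
  have heq : Set.EqOn (Function.update b j c) b {j}ᶜ := fun i hi => Function.update_of_ne hi _ _
  have hOn : LinearIndepOn ℚ (Function.update b j c) {j}ᶜ :=
    (linearIndepOn_congr heq).2 (hb.linearIndepOn _)
  have him : Function.update b j c '' {j}ᶜ = b '' {j}ᶜ := Set.image_congr heq
  have := hOn.insert (x := j) (by rwa [him, Function.update_self])
  rwa [Set.insert_eq, Set.union_compl_self, linearIndepOn_univ_iff] at this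

/-! ### Lower bounds for heights of primes -/

open MvPolynomial

section GroupAlgebra

/-- In a group algebra, `g - 1` is regular when `g` has infinite order. -/
theorem single_sub_one_mem_nonZeroDivisors {k G : Type*} [CommRing k] [AddCommGroup G] {g : G}
    (hg : ∀ z : ℤ, z • g = 0 → z = 0) :
    (AddMonoidAlgebra.single g 1 - 1 : AddMonoidAlgebra k G) ∈
      nonZeroDivisors (AddMonoidAlgebra k G) := by
  rw [mem_nonZeroDivisors_iff_left]
  intro a ha
  by_contra ha0
  have hfix : AddMonoidAlgebra.single g 1 * a = a := by
    rw [sub_mul, one_mul, sub_eq_zero] at ha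
    exact ha
  have hshift : ∀ h, a.coeff (-g + h) = a.coeff h := fun h => by
    conv_rhs => rw [← hfix, AddMonoidAlgebra.coeff_single_mul_apply, one_mul]
  obtain ⟨h, hh⟩ : ∃ h, a.coeff h ≠ 0 := by
    by_contra! H
    exact ha0 (AddMonoidAlgebra.ext (Finsupp.ext H))
  -- Invariance under translation by `g` would make the finite support of `a` infinite.
  have hall : ∀ k : ℕ, a.coeff (h - k • g) ≠ 0 := by
    intro k
    induction k with
    | zero => simpa using hh
    | succ k ih =>
      rw [show h - (k + 1) • g = -g + (h - k • g) by rw [succ_nsmul]; abel, hshift]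
      exact ih
  refine Set.infinite_of_injective_forall_mem (f := fun k : ℕ => h - k • g) (fun k l hkl => ?_)
    (fun k => Finsupp.mem_support_iff.2 (hall k)) a.coeff.support.finite_toSet
  have : ((k : ℤ) - l) • g = 0 := by
    have := sub_right_injective hkl
    rw [sub_smul, natCast_zsmul, natCast_zsmul, this, sub_self]
  have := hg _ this
  omega

end GroupAlgebra

/-- The specialisation `x_i ↦ 0` for `i ∈ K`. -/
def killVars (K : Finset (Fin n)) : MvPolynomial (Fin n) ℂ →ₐ[ℂ] MvPolynomial (Fin n) ℂ :=
  aeval fun i => if i ∈ K then 0 else X i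

/-- Setting variables of `P` to zero does not change residues modulo `P`. -/
theorem ker_killVars_le {K : Finset (Fin n)} {P : Ideal (MvPolynomial (Fin n) ℂ)}
    (h : ∀ i ∈ K, X i ∈ P) : RingHom.ker (killVars K) ≤ P := by
  have hcomp : (Ideal.Quotient.mkₐ ℂ P).comp (killVars K) = Ideal.Quotient.mkₐ ℂ P := by
    ext i
    by_cases hi : i ∈ K
    · simpa [killVars, hi] using (Ideal.Quotient.eq_zero_iff_mem.2 (h i hi)).symm
    · simp [killVars, hi]
  intro f hf
  have := DFunLike.congr_fun hcomp f
  rw [AlgHom.comp_apply, (RingHom.mem_ker).1 hf, map_zero] at this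
  exact Ideal.Quotient.eq_zero_iff_mem.1 this.symm

theorem card_le_height_ker_killVars (K : Finset (Fin n)) :
    (K.card : ℕ∞) ≤ (RingHom.ker (killVars K)).height := by
  induction K using Finset.induction_on with
  | empty => simp
  | insert a K ha ih =>
    have : (RingHom.ker (killVars K)).IsPrime := RingHom.ker_isPrime _
    have : (RingHom.ker (killVars (insert a K))).IsPrime := RingHom.ker_isPrime _
    have hlt : RingHom.ker (killVars K) < RingHom.ker (killVars (insert a K)) := by
      refine lt_of_le_of_ne (ker_killVars_le fun i hi => ?_) fun h => ?_
      · simp [RingHom.mem_ker, killVars, hi]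
      · have : (X a : MvPolynomial (Fin n) ℂ) ∈ RingHom.ker (killVars K) := by
          rw [h]; simp [RingHom.mem_ker, killVars]
        simp [RingHom.mem_ker, killVars, ha] at this
    rw [Finset.card_insert_of_notMem ha]
    push_cast
    exact (add_le_add_left ih 1).trans (Ideal.height_add_one_le_of_lt_of_isPrime hlt)

/-- The map `x_i ↦ 0` for `i ∈ K` and `x_i ↦ [e_i]` otherwise, with values in the group algebra of
`ℤ^n / N`. -/
def toGroupAlgebra (K : Finset (Fin n)) (N : Submodule ℤ (Fin n → ℤ)) :
    MvPolynomial (Fin n) ℂ →ₐ[ℂ] AddMonoidAlgebra ℂ ((Fin n → ℤ) ⧸ N) :=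
  aeval fun i => if i ∈ K then 0 else AddMonoidAlgebra.single (N.mkQ (Pi.single i 1)) 1

theorem toGroupAlgebra_monomial {K : Finset (Fin n)} (N : Submodule ℤ (Fin n → ℤ))
    {u : Fin n →₀ ℕ} (hu : ∀ i ∈ K, u i = 0) :
    toGroupAlgebra K N (monomial u 1) =
      AddMonoidAlgebra.single (N.mkQ fun i => (u i : ℤ)) 1 := by
  rw [toGroupAlgebra, aeval_monomial, map_one, one_mul, Finsupp.prod_fintype _ _ (by simp)]
  have h1 : ∀ i, (if i ∈ K then (0 : AddMonoidAlgebra ℂ ((Fin n → ℤ) ⧸ N)) else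
      AddMonoidAlgebra.single (N.mkQ (Pi.single i 1)) 1) ^ u i =
      AddMonoidAlgebra.of ℂ _ (Multiplicative.ofAdd (N.mkQ (Pi.single i (u i : ℤ)))) := by
    intro i
    by_cases hi : i ∈ K
    · simp [hi, hu i hi, AddMonoidAlgebra.one_def]
    · rw [if_neg hi, AddMonoidAlgebra.single_pow, one_pow, AddMonoidAlgebra.of_apply, toAdd_ofAdd,
        ← map_nsmul]
      congr 2
      ext j
      by_cases hj : j = i <;> simp [hj]
  rw [Finset.prod_congr rfl fun i _ => h1 i, ← map_prod, ← ofAdd_sum, ← map_sum,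
    Finset.univ_sum_single, AddMonoidAlgebra.of_apply, toAdd_ofAdd]

theorem posExponent_sub (v : Fin n → ℤ) :
    (fun i => (posExponent v i : ℤ)) = (fun i => (posExponent (-v) i : ℤ)) + v := by
  ext i
  simp [posExponent]
  omega

theorem toGroupAlgebra_binomial {K : Finset (Fin n)} (N : Submodule ℤ (Fin n → ℤ))
    {v : Fin n → ℤ} (hv : ∀ i ∈ K, v i = 0) :
    toGroupAlgebra K N (binomial v) =
      AddMonoidAlgebra.single (N.mkQ fun i => (posExponent (-v) i : ℤ)) 1 *
        (AddMonoidAlgebra.single (N.mkQ v) 1 - 1) := by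
  rw [binomial, map_sub, toGroupAlgebra_monomial N (fun i hi => by simp [posExponent, hv i hi]),
    toGroupAlgebra_monomial N (fun i hi => by simp [posExponent, hv i hi]), posExponent_sub v,
    map_add, mul_sub, mul_one, AddMonoidAlgebra.single_mul_single, mul_one]

theorem isUnit_single {k G : Type*} [CommRing k] [AddCommGroup G] (g : G) :
    IsUnit (AddMonoidAlgebra.single g 1 : AddMonoidAlgebra k G) :=
  IsUnit.of_mul_eq_one (AddMonoidAlgebra.single (-g) 1) (by
    rw [AddMonoidAlgebra.single_mul_single, add_neg_cancel, mul_one, AddMonoidAlgebra.one_def])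

theorem prod_zpow_eq_div {F : Type*} [Field F] {y : Fin n → F} (hy : ∀ i, y i ≠ 0)
    (v : Fin n → ℤ) :
    ∏ i, y i ^ v i = (∏ i, y i ^ posExponent v i) / ∏ i, y i ^ posExponent (-v) i := by
  rw [← Finset.prod_div_distrib]
  refine Finset.prod_congr rfl fun i _ => ?_
  rw [← zpow_natCast, ← zpow_natCast, ← zpow_sub₀ (hy i)]
  congr 1
  simp [posExponent]

/-- The residue map of a prime factors through the group algebra of `ℤ^n / N` if `N` is spanned by
vectors that vanish on `K` and have their binomials in the prime. -/
theorem exists_factor_toGroupAlgebra {P : Ideal (MvPolynomial (Fin n) ℂ)} [P.IsPrime]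
    {K : Finset (Fin n)} (hK : ∀ i, i ∈ K ↔ X i ∈ P) {S : Set (Fin n → ℤ)}
    (hS : ∀ v ∈ S, (∀ i ∈ K, v i = 0) ∧ binomial v ∈ P) :
    ∃ ψ : AddMonoidAlgebra ℂ ((Fin n → ℤ) ⧸ Submodule.span ℤ S) →ₐ[ℂ] P.ResidueField,
      ψ.comp (toGroupAlgebra K (Submodule.span ℤ S)) =
        IsScalarTower.toAlgHom ℂ (MvPolynomial (Fin n) ℂ) P.ResidueField := by
  set π := algebraMap (MvPolynomial (Fin n) ℂ) P.ResidueField with hπ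
  have hker : ∀ f, π f = 0 ↔ f ∈ P := fun f => by
    rw [← RingHom.mem_ker, hπ, Ideal.ker_algebraMap_residueField]
  let y : Fin n → P.ResidueField := fun i => if i ∈ K then 1 else π (X i)
  have hy : ∀ i, y i ≠ 0 := by
    intro i
    by_cases hi : i ∈ K
    · simp [y, hi]
    · simp only [y, hi, if_false, ne_eq, hker]
      rwa [← hK]
  let χ : (Fin n → ℤ) →+ Additive P.ResidueFieldˣ :=
    { toFun := fun v => Additive.ofMul (∏ i, (Units.mk0 (y i) (hy i)) ^ v i)
      map_zero' := by simp
      map_add' := fun v w => by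
        simp [zpow_add, Finset.prod_mul_distrib] }
  have hmon : ∀ u : Fin n →₀ ℕ, (∀ i ∈ K, u i = 0) → ∏ i, y i ^ u i = π (monomial u 1) := by
    intro u hu
    rw [monomial_eq, map_mul, C_1, map_one, one_mul, Finsupp.prod_fintype _ _ (by simp), map_prod]
    refine Finset.prod_congr rfl fun i _ => ?_
    by_cases hi : i ∈ K
    · simp [hu i hi]
    · simp [y, hi]
  have hχ : Submodule.span ℤ S ≤ LinearMap.ker χ.toIntLinearMap := by
    refine Submodule.span_le.2 fun v hv => ?_
    obtain ⟨h0, hb⟩ := hS v hv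
    have h1 : ∏ i, y i ^ v i = 1 := by
      have hne : (∏ i, y i ^ posExponent (-v) i) ≠ 0 :=
        Finset.prod_ne_zero_iff.2 fun i _ => pow_ne_zero _ (hy i)
      rw [prod_zpow_eq_div hy, div_eq_one_iff_eq hne,
        hmon _ (fun i hi => by simp [posExponent, h0 i hi]),
        hmon _ (fun i hi => by simp [posExponent, h0 i hi]), ← sub_eq_zero, ← map_sub, hker]
      exact hb
    rw [SetLike.mem_coe, LinearMap.mem_ker]
    change Additive.ofMul (∏ i, (Units.mk0 (y i) (hy i)) ^ v i) = 0
    rw [ofMul_eq_zero]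
    ext
    simpa using h1
  let χ' := ((Submodule.span ℤ S).liftQ χ.toIntLinearMap hχ).toAddMonoidHom
  refine ⟨AddMonoidAlgebra.lift ℂ _ _ ((Units.coeHom _).comp (AddMonoidHom.toMultiplicativeLeft χ')), ?_⟩
  ext i
  by_cases hi : i ∈ K
  · simpa [toGroupAlgebra, hi] using ((hker _).2 ((hK i).1 hi)).symm
  · have : χ (Pi.single i 1) = Additive.ofMul (Units.mk0 (y i) (hy i)) := by
      change Additive.ofMul (∏ j, _) = _
      congr 1
      rw [Finset.prod_eq_single i] <;> simp +contextual
    simp [toGroupAlgebra, hi, χ', this, y, hπ]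

/-- A prime of the polynomial ring which contains the variables in `K`, no other variable, and the
binomials of linearly independent vectors vanishing on `K` has height at least the number of these
elements. -/
theorem card_add_card_le_height {ι : Type*} [DecidableEq ι] {w : ι → Fin n → ℤ}
    (hw : LinearIndependent ℤ w) {K : Finset (Fin n)} (T : Finset ι)
    (hT : ∀ j ∈ T, ∀ i ∈ K, w j i = 0) (P : Ideal (MvPolynomial (Fin n) ℂ)) [hP : P.IsPrime]
    (hK : ∀ i, i ∈ K ↔ X i ∈ P) (hb : ∀ j ∈ T, binomial (w j) ∈ P) :
    ((K.card + T.card : ℕ) : ℕ∞) ≤ P.height := by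
  induction T using Finset.induction_on generalizing P with
  | empty =>
    simpa using (card_le_height_ker_killVars K).trans
      (Ideal.height_mono (ker_killVars_le fun i hi => (hK i).1 hi))
  | insert a T ha ih =>
    set S : Set (Fin n → ℤ) := w '' T with hS
    set N := Submodule.span ℤ S with hN
    set φ := toGroupAlgebra K N with hφ
    obtain ⟨ψ, hψ⟩ := exists_factor_toGroupAlgebra (P := P) hK (S := S) (by
      rintro _ ⟨j, hj, rfl⟩
      exact ⟨hT j (Finset.mem_insert_of_mem hj), hb j (Finset.mem_insert_of_mem hj)⟩)
    have hker : ∀ f, ψ (φ f) = 0 ↔ f ∈ P := fun f => by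
      have := DFunLike.congr_fun hψ f
      rw [AlgHom.comp_apply] at this
      rw [this, IsScalarTower.toAlgHom_apply, ← RingHom.mem_ker, Ideal.ker_algebraMap_residueField]
    have : (RingHom.ker ψ).IsPrime := RingHom.ker_isPrime _
    -- The quotient by `N` may have torsion, so the group algebra need not be a domain; a minimal
    -- prime replaces zero. It avoids the regular element `[w a] - 1`, so its preimage is strictly
    -- below `P`, but still contains `K` and the binomials from `T`.
    obtain ⟨q, hq, hqψ⟩ := Ideal.exists_minimalPrimes_le (bot_le : ⊥ ≤ RingHom.ker ψ)
    have hqp : q.IsPrime := hq.isPrime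
    have hQ : (q.comap φ).IsPrime := Ideal.comap_isPrime _ _
    have hQP : q.comap φ ≤ P := fun f hf => (hker f).1 (hqψ hf)
    have hnot : binomial (w a) ∉ q.comap φ := by
      intro h
      rw [Ideal.mem_comap, hφ, toGroupAlgebra_binomial N (hT a (Finset.mem_insert_self a T))] at h
      rcases hqp.mem_or_mem h with h | h
      · exact hqp.ne_top (Ideal.eq_top_of_isUnit_mem _ h (isUnit_single _))
      · refine notMem_nonZeroDivisors_of_mem_mem_minimalPrimes h hq
          (single_sub_one_mem_nonZeroDivisors fun z hz => ?_)
        rw [← map_smul, Submodule.mkQ_apply, Submodule.Quotient.mk_eq_zero] at hz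
        refine hw.eq_zero_of_smul_mem_span a z (Submodule.span_mono (Set.image_mono ?_) hz)
        rintro j hj
        refine ⟨trivial, ?_⟩
        rintro rfl
        exact ha hj
    have hlt : q.comap φ < P :=
      lt_of_le_of_ne hQP fun h => hnot (h ▸ hb a (Finset.mem_insert_self a T))
    have hih := ih (fun j hj => hT j (Finset.mem_insert_of_mem hj)) (q.comap φ) (fun i => by
        refine ⟨fun hi => ?_, fun hi => (hK i).2 (hQP hi)⟩
        simp [Ideal.mem_comap, hφ, toGroupAlgebra, hi]) (fun j hj => by
        have hz : N.mkQ (w j) = 0 := by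
          rw [Submodule.mkQ_apply, Submodule.Quotient.mk_eq_zero]
          exact Submodule.subset_span ⟨j, hj, rfl⟩
        rw [Ideal.mem_comap, hφ,
          toGroupAlgebra_binomial N (hT j (Finset.mem_insert_of_mem hj)), hz,
          ← AddMonoidAlgebra.one_def, sub_self, mul_zero]
        exact zero_mem _)
    rw [Finset.card_insert_of_notMem ha, ← add_assoc]
    push_cast at hih ⊢
    exact (add_le_add_left hih 1).trans (Ideal.height_add_one_le_of_lt_of_isPrime hlt)

/-! ### Lattice binomials and the variables in a prime -/

theorem sum_eq_zero_of_mem_kernelLattice {A : Matrix (Fin m) (Fin n) ℤ} (hA : IsConfiguration A)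
    {v : Fin n → ℤ} (hv : v ∈ kernelLattice A) : ∑ i, v i = 0 := by
  have key : ∀ x ∈ Submodule.span ℚ (Set.range (A.map (Int.cast : ℤ → ℚ)).row),
      ∑ i, x i * (v i : ℚ) = 0 := by
    intro x hx
    induction hx using Submodule.span_induction with
    | mem x hx =>
      obtain ⟨k, rfl⟩ := hx
      have := congrFun (LinearMap.mem_ker.1 hv) k
      simp only [Matrix.mulVecLin_apply, Matrix.mulVec, dotProduct, Pi.zero_apply] at this
      simpa [Matrix.row] using congrArg (Int.cast : ℤ → ℚ) this
    | zero => simp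
    | add x y _ _ hx hy => simp [add_mul, Finset.sum_add_distrib, hx, hy]
    | smul a x _ hx => simp [mul_assoc, ← Finset.mul_sum, hx]
  have := key _ hA.one_mem_span_row
  simp only [one_mul] at this
  exact_mod_cast this

theorem binomial_mem_toricIdeal {A : Matrix (Fin m) (Fin n) ℤ} {v : Fin n → ℤ}
    (hv : v ∈ kernelLattice A) : binomial v ∈ toricIdeal A := by
  refine Ideal.subset_span ⟨posExponent v, posExponent (-v), ?_, rfl⟩
  rw [posExponent_sub v, Matrix.mulVec_add]
  have : A.mulVec v = 0 := LinearMap.mem_ker.1 hv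
  rw [this, add_zero]

theorem constantCoeff_binomial {v : Fin n → ℤ} (hv : ∑ i, v i = 0) :
    constantCoeff (binomial v) = 0 := by
  by_cases h0 : v = 0
  · simp [binomial, h0]
  obtain ⟨i, hi⟩ : ∃ i, v i ≠ 0 := by
    by_contra! h
    exact h0 (funext h)
  have hne : ∀ u : Fin n → ℤ, (∃ i, 0 < u i) → posExponent u ≠ 0 := by
    rintro u ⟨i, hi⟩ h
    have := DFunLike.congr_fun h i
    simp [posExponent] at this
    omega
  obtain ⟨j, -, hj⟩ := Finset.exists_pos_of_sum_zero_of_exists_nonzero v hv ⟨i, Finset.mem_univ i, hi⟩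
  obtain ⟨k, -, hk⟩ := Finset.exists_pos_of_sum_zero_of_exists_nonzero (-v)
    (by simpa using hv) ⟨i, Finset.mem_univ i, by simpa using hi⟩
  simp [binomial, constantCoeff_monomial, hne v ⟨j, hj⟩, hne (-v) ⟨k, hk⟩]

theorem monomial_mem_of_X_mem {I : Ideal (MvPolynomial (Fin n) ℂ)} {u : Fin n →₀ ℕ} {i : Fin n}
    (hi : X i ∈ I) (hu : u i ≠ 0) : monomial u 1 ∈ I :=
  Ideal.mem_of_dvd I (X_dvd_monomial.2 (Or.inr hu)) hi

theorem exists_X_mem_of_monomial_mem {P : Ideal (MvPolynomial (Fin n) ℂ)} [hP : P.IsPrime]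
    {u : Fin n →₀ ℕ} (h : monomial u 1 ∈ P) : ∃ i, X i ∈ P ∧ u i ≠ 0 := by
  rw [monomial_eq, C_1, one_mul, Finsupp.prod, hP.prod_mem_iff] at h
  obtain ⟨i, hi, hiP⟩ := h
  exact ⟨i, hP.mem_of_pow_mem _ hiP, Finsupp.mem_support_iff.1 hi⟩

theorem binomial_mem_of_mixed {I : Ideal (MvPolynomial (Fin n) ℂ)} {v : Fin n → ℤ}
    (hpos : ∃ i, X i ∈ I ∧ 0 < v i) (hneg : ∃ i, X i ∈ I ∧ v i < 0) : binomial v ∈ I := by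
  obtain ⟨i, hi, hvi⟩ := hpos
  obtain ⟨j, hj, hvj⟩ := hneg
  refine sub_mem (monomial_mem_of_X_mem hi ?_) (monomial_mem_of_X_mem hj ?_)
  · simp [posExponent]; omega
  · simp [posExponent]; omega

/-- If a prime contains the binomial of `v` and a variable in the support of `v`, then it contains
variables at which `v` is positive and variables at which `v` is negative. -/
theorem mixed_of_binomial_mem {P : Ideal (MvPolynomial (Fin n) ℂ)} [P.IsPrime] {v : Fin n → ℤ}
    (hv : binomial v ∈ P) {i : Fin n} (hi : X i ∈ P) (hvi : v i ≠ 0) :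
    (∃ i, X i ∈ P ∧ 0 < v i) ∧ ∃ i, X i ∈ P ∧ v i < 0 := by
  rcases lt_or_gt_of_ne hvi with h | h
  · refine ⟨?_, i, hi, h⟩
    have h1 : monomial (posExponent (-v)) (1 : ℂ) ∈ P :=
      monomial_mem_of_X_mem hi (by simp [posExponent]; omega)
    obtain ⟨j, hj, hvj⟩ := exists_X_mem_of_monomial_mem ((Submodule.sub_mem_iff_left P h1).1 hv)
    exact ⟨j, hj, by simp [posExponent] at hvj; omega⟩
  · refine ⟨⟨i, hi, h⟩, ?_⟩
    have h1 : monomial (posExponent v) (1 : ℂ) ∈ P :=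
      monomial_mem_of_X_mem hi (by simp [posExponent]; omega)
    obtain ⟨j, hj, hvj⟩ := exists_X_mem_of_monomial_mem ((Submodule.sub_mem_iff_right P h1).1 hv)
    exact ⟨j, hj, by simp [posExponent] at hvj; omega⟩

/-! ### Complete intersection as a height bound -/

theorem height_span_finset_le {R : Type*} [CommRing R] [IsNoetherianRing R] {s : Finset R}
    (hs : Ideal.span (s : Set R) ≠ ⊤) : (Ideal.span (s : Set R)).height ≤ s.card := by
  obtain ⟨p, hp⟩ := Ideal.nonempty_minimalPrimes hs
  exact (Ideal.height_mono hp.1.2).trans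
    (Ideal.height_le_card_of_mem_minimalPrimes_span_finset hp)

/-- The ideal generated by the binomials of a family of integer vectors. -/
def familyIdeal (w : Fin r → Fin n → ℤ) : Ideal (MvPolynomial (Fin n) ℂ) :=
  Ideal.span (Set.range fun j => binomial (w j))

theorem binomial_mem_familyIdeal (w : Fin r → Fin n → ℤ) (j : Fin r) :
    binomial (w j) ∈ familyIdeal w :=
  Ideal.subset_span ⟨j, rfl⟩

theorem familyIdeal_le_iff {w : Fin r → Fin n → ℤ} {I : Ideal (MvPolynomial (Fin n) ℂ)} :
    familyIdeal w ≤ I ↔ ∀ j, binomial (w j) ∈ I := by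
  rw [familyIdeal, Ideal.span_le, Set.range_subset_iff]
  rfl

/-- A minimal prime vanishing at $(1,\dots,1)$ contains no variable, so its height is at least $r$;
Krull bounds it by the number of generators, which is the height of the ideal. -/
theorem le_height_of_isCompleteIntersection {w : Fin r → Fin n → ℤ} (hw : LinearIndependent ℤ w)
    (h : IsCompleteIntersection (familyIdeal w)) : (r : ℕ∞) ≤ (familyIdeal w).height := by
  obtain ⟨s, hs, hcard⟩ := h
  let ε : MvPolynomial (Fin n) ℂ →+* ℂ := eval 1
  have : (RingHom.ker ε).IsPrime := RingHom.ker_isPrime _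
  have hle : familyIdeal w ≤ RingHom.ker ε := familyIdeal_le_iff.2 fun j => by
    simp [ε, RingHom.mem_ker, binomial, eval_monomial]
  obtain ⟨P, hP, hPε⟩ := Ideal.exists_minimalPrimes_le hle
  have hPp : P.IsPrime := hP.isPrime
  have hlow := card_add_card_le_height hw (K := ∅) Finset.univ (by simp) P (fun i => by
    refine iff_of_false (by simp) fun hi => ?_
    have := hPε hi
    simp [ε, RingHom.mem_ker] at this) fun j _ => hP.1.2 (binomial_mem_familyIdeal w j)
  rw [← hcard]
  refine le_trans ?_ (Ideal.height_le_card_of_mem_minimalPrimes_span_finset (p := P) (by rwa [hs]))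
  simpa using hlow

theorem isCompleteIntersection_of_le_height {w : Fin r → Fin n → ℤ} (hw : ∀ j, ∑ i, w j i = 0)
    (h : (r : ℕ∞) ≤ (familyIdeal w).height) : IsCompleteIntersection (familyIdeal w) := by
  classical
  have hspan : Ideal.span ((Finset.univ.image fun j => binomial (w j) : Finset _) : Set _) =
      familyIdeal w := by simp [familyIdeal]
  have hne : familyIdeal w ≠ ⊤ := by
    refine ne_top_of_le_ne_top (RingHom.ker_ne_top (constantCoeff (σ := Fin n) (R := ℂ))) ?_
    exact familyIdeal_le_iff.2 fun j => constantCoeff_binomial (hw j)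
  refine ⟨_, hspan, le_antisymm (le_trans ?_ h) ?_⟩
  -- Coinciding binomials could only shrink the generating set, so an inequality suffices.
  · exact_mod_cast Finset.card_image_le.trans (by simp)
  · rw [← hspan]
    exact height_span_finset_le (by rwa [hspan])

/-! ### Exchanging vectors for circuits -/

/-- Replacing a vector by a conformal one preserves the height of the binomial ideal. -/
theorem le_height_familyIdeal_update {w : Fin r → Fin n → ℤ} {j : Fin r} {c : Fin n → ℤ}
    (hli : LinearIndependent ℤ (Function.update w j c)) (hw : ∀ k, ∑ i, w k i = 0)
    (hc : Conformal c (w j)) (h : (r : ℕ∞) ≤ (familyIdeal w).height) :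
    (r : ℕ∞) ≤ (familyIdeal (Function.update w j c)).height := by
  classical
  rw [Ideal.height_eq_inf_minimalPrimes]
  refine le_iInf₂ fun P hP => ?_
  have hPp : P.IsPrime := hP.isPrime
  have hmem : ∀ k, binomial (Function.update w j c k) ∈ P := familyIdeal_le_iff.1 hP.1.2
  have hmem' : ∀ k ≠ j, binomial (w k) ∈ P := fun k hk => by
    simpa [Function.update_of_ne hk] using hmem k
  have hcP : binomial c ∈ P := by simpa using hmem j
  by_cases hcK : ∀ i, X i ∈ P → c i = 0
  · let K : Finset (Fin n) := Finset.univ.filter fun i => X i ∈ P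
    have hK : ∀ i, i ∈ K ↔ X i ∈ P := by simp [K]
    let T : Finset (Fin r) := Finset.univ.filter fun k => ∀ i ∈ K, Function.update w j c k i = 0
    have hlow := card_add_card_le_height hli (K := K) T
      (fun k hk => (Finset.mem_filter.1 hk).2) P hK fun k _ => hmem k
    refine le_trans ?_ hlow
    -- `T` is read off the new family, but the generators are old binomials. Since `c` vanishes on
    -- `K`, `j ∈ T`, so the old `binomial (w j)` is included; it need not lie in `P`, as only the
    -- number of generators matters.
    let s : Finset (MvPolynomial (Fin n) ℂ) := K.image X ∪ T.image fun k => binomial (w k)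
    have hXs : ∀ i ∈ K, (X i : MvPolynomial (Fin n) ℂ) ∈ Ideal.span (s : Set _) := fun i hi =>
      Ideal.subset_span (Finset.mem_union_left _ (Finset.mem_image_of_mem _ hi))
    have hle : familyIdeal w ≤ Ideal.span (s : Set _) := by
      refine familyIdeal_le_iff.2 fun k => ?_
      by_cases hk : k ∈ T
      · exact Ideal.subset_span (Finset.mem_union_right _
          (Finset.mem_image_of_mem (fun k => binomial (w k)) hk))
      · have hkj : k ≠ j := by
          rintro rfl
          exact hk (Finset.mem_filter.2 ⟨Finset.mem_univ _, fun i hi => by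
            simpa using hcK i ((hK i).1 hi)⟩)
        obtain ⟨i, hi, hki⟩ : ∃ i ∈ K, w k i ≠ 0 := by
          by_contra! H
          exact hk (Finset.mem_filter.2 ⟨Finset.mem_univ _, fun i hi => by
            rw [Function.update_of_ne hkj]; exact H i hi⟩)
        obtain ⟨⟨a, ha, hpos⟩, b, hb, hneg⟩ :=
          mixed_of_binomial_mem (hmem' k hkj) ((hK i).1 hi) hki
        exact binomial_mem_of_mixed ⟨a, hXs a ((hK a).2 ha), hpos⟩ ⟨b, hXs b ((hK b).2 hb), hneg⟩
    have hne : Ideal.span (s : Set (MvPolynomial (Fin n) ℂ)) ≠ ⊤ := by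
      refine ne_top_of_le_ne_top (RingHom.ker_ne_top (constantCoeff (σ := Fin n) (R := ℂ))) ?_
      refine Ideal.span_le.2 fun f hf => ?_
      rcases Finset.mem_union.1 hf with hf | hf
      · obtain ⟨i, -, rfl⟩ := Finset.mem_image.1 hf
        simp [RingHom.mem_ker]
      · obtain ⟨k, -, rfl⟩ := Finset.mem_image.1 hf
        exact constantCoeff_binomial (hw k)
    refine (h.trans (Ideal.height_mono hle)).trans ((height_span_finset_le hne).trans ?_)
    exact_mod_cast (Finset.card_union_le _ _).trans
      (add_le_add Finset.card_image_le Finset.card_image_le)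
  -- Here conformality carries the mixed signs from `c` to `w j`, so `P` contains the whole old
  -- ideal.
  · push Not at hcK
    obtain ⟨i, hi, hci⟩ := hcK
    obtain ⟨⟨a, ha, hpos⟩, b, hb, hneg⟩ := mixed_of_binomial_mem hcP hi hci
    refine h.trans (Ideal.height_mono (familyIdeal_le_iff.2 fun k => ?_))
    by_cases hk : k = j
    · subst hk
      exact binomial_mem_of_mixed ⟨a, ha, (hc a).1 hpos⟩ ⟨b, hb, (hc b).2 hneg⟩
    · exact hmem' k hk

theorem linearIndependent_int_of_ratCast {ι : Type*} {w : ι → Fin n → ℤ}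
    (h : LinearIndependent ℚ fun j => ratCast (w j)) : LinearIndependent ℤ w := by
  let f : (Fin n → ℤ) →ₗ[ℤ] (Fin n → ℚ) :=
    { toFun := ratCast
      map_add' := fun x y => by ext; simp [ratCast]
      map_smul' := fun x y => by ext; simp [ratCast] }
  refine LinearIndependent.of_comp f (h.restrict_scalars (R := ℤ) fun a b hab => ?_)
  simpa using hab

/-- The vectors of a family can be exchanged one by one for circuits without lowering the height of
the binomial ideal. -/
theorem exists_circuit_family {A : Matrix (Fin m) (Fin n) ℤ} (hA : IsConfiguration A)
    {w : Fin r → Fin n → ℤ} (hw : ∀ j, w j ∈ kernelLattice A)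
    (hli : LinearIndependent ℚ fun j => ratCast (w j))
    (h : (r : ℕ∞) ≤ (familyIdeal w).height) (s : Finset (Fin r)) :
    ∃ w' : Fin r → Fin n → ℤ, (∀ j, w' j ∈ kernelLattice A) ∧
      (LinearIndependent ℚ fun j => ratCast (w' j)) ∧
      (r : ℕ∞) ≤ (familyIdeal w').height ∧ ∀ j ∈ s, IsCircuit A (w' j) := by
  classical
  induction s using Finset.induction_on with
  | empty => exact ⟨w, hw, hli, h, by simp⟩
  | insert j s _ ih =>
    obtain ⟨w', hw', hli', h', hs⟩ := ih
    have hne : w' j ≠ 0 := fun h0 => hli'.ne_zero j (by ext; simp [ratCast, h0])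
    obtain ⟨_, ⟨c, ⟨hcirc, hconf⟩, rfl⟩, hupd⟩ := exists_linearIndependent_update hli' j
      (exists_conformal_circuits_span (hw' j) hne)
    have hupd' : LinearIndependent ℚ fun k => ratCast (Function.update w' j c k) := by
      rw [show (fun k => ratCast (Function.update w' j c k)) =
        Function.update (fun k => ratCast (w' k)) j (ratCast c) from
        Function.comp_update ratCast w' j c]
      exact hupd
    refine ⟨Function.update w' j c, fun k => ?_, hupd',
      le_height_familyIdeal_update (linearIndependent_int_of_ratCast hupd')
        (fun k => sum_eq_zero_of_mem_kernelLattice hA (hw' k)) hconf h', fun k hk => ?_⟩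
    · by_cases hkj : k = j
      · subst hkj; simpa using hcirc.1
      · simpa [hkj] using hw' k
    · by_cases hkj : k = j
      · subst hkj; simpa using hcirc
      · simpa [hkj] using hs k (Finset.mem_of_mem_insert_of_ne hk hkj)

end

end ToricCI

theorem proposition2p5 {m n : ℕ} (A : Matrix (Fin m) (Fin n) ℤ) (hA : ToricCI.IsConfiguration A) :
    (∃ B : Matrix (Fin n) (Fin (n - m)) ℤ,
        ToricCI.IsLatticeVectorSpaceBasis A B ∧
        ToricCI.basisIdeal B ≤ ToricCI.toricIdeal A ∧
        ToricCI.IsCompleteIntersection (ToricCI.basisIdeal B)) ↔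
    (∃ B : Matrix (Fin n) (Fin (n - m)) ℤ,
        ToricCI.IsLatticeVectorSpaceBasis A B ∧
        ToricCI.basisIdeal B ≤ ToricCI.toricIdeal A ∧
        ToricCI.IsCompleteIntersection (ToricCI.basisIdeal B) ∧
        ∀ j, ToricCI.IsCircuit A (B.col j)) := by
  constructor
  · rintro ⟨B, hB, -, hCI⟩
    have hli : LinearIndependent ℚ fun j => ToricCI.ratCast (B.col j) := hB.linearIndependent
    obtain ⟨w, hw, hwli, hht, hcirc⟩ := ToricCI.exists_circuit_family hA hB.col_mem hli
      (ToricCI.le_height_of_isCompleteIntersection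
        (ToricCI.linearIndependent_int_of_ratCast hli) hCI) Finset.univ
    exact ⟨Matrix.of fun i j => w j i, ⟨hw, hwli⟩,
      ToricCI.familyIdeal_le_iff.2 fun j => ToricCI.binomial_mem_toricIdeal (hw j),
      ToricCI.isCompleteIntersection_of_le_height
        (fun j => ToricCI.sum_eq_zero_of_mem_kernelLattice hA (hw j)) hht,
      fun j => hcirc j (Finset.mem_univ j)⟩
  · rintro ⟨B, hB, hle, hCI, -⟩
    exact ⟨B, hB, hle, hCI⟩
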